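/- Let $s$ be a positive integer, let $\alpha\in\mathbf{F}_{2^s}^*$, and for a polynomial $f\in\mathbf{F}_{2^s}[x]$ of positive degree $m$ put $f^{(Q,\alpha)}(x)=x^m f(x+\alpha x^{-1})\in\mathbf{F}_{2^s}[x]$. Let $\theta_\alpha$ be the map on $\overline{\mathbf{F}}_{2^s}\cup\{\infty\}$ (where $\overline{\mathbf{F}}_{2^s}$ is an algebraic closure of $\mathbf{F}_{2^s}$) with $\theta_\alpha(0)=\theta_\alpha(\infty)=\infty$ and $\theta_\alpha(x)=x+\alpha x^{-1}$ otherwise; an element $\beta$ is called $\theta_\alpha$-periodic if $\theta_\alpha^k(\beta)=\beta$ for some positive integer $k$. Let $f_0\in\mathbf{F}_{2^s}[x]$ be an irreducible monic polynomial of positive degree $n$, and let $2^{l_s}$ and $2^{l_n}$ be the greatest powers of $2$ dividing $s$ and $n$ respectively. Let $f_1$ be an irreducible monic factor of $f_0^{(Q,\alpha)}$ none of whose roots is $\theta_\alpha$-periodic, and for each $i\ge 2$ let $f_i$ be any irreducible monic factor of $f_{i-1}^{(Q,\alpha)}$. Then there exists a positive integer $t\le l_s+l_n+3$ such that $\deg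 f_t=2n$ and $\deg f_{t+1}=4n$. Moreover, for this $t$ and for every $i\ge t$, the polynomial $f_i^{(Q,\alpha)}$ is irreducible in $\mathbf{F}_{2^s}[x]$ and $\deg f_{i+1}=2\deg f_i$. -/

import Mathlib

open Polynomial

/-- The `(Q, a)`-transform `x ^ n * f (x + a * x⁻¹)` of a polynomial `f` of degree `n`, written as a
polynomial: the term `c x ^ k` of `f` contributes `c * (x ^ 2 + a) ^ k * x ^ (n - k)`. -/
noncomputable def qTransform {F : Type*} [Field F] (a : F) (f : F[X]) : F[X] :=
  f.sum fun k c => C c * (X ^ 2 + C a) ^ k * X ^ (f.natDegree - k)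

/-- In the field of rational functions, `qTransform a f` is `x ^ n * f (x + a * x⁻¹)`. -/
theorem qTransform_eq {F : Type*} [Field F] (a : F) (f : F[X]) :
    algebraMap F[X] (RatFunc F) (qTransform a f) =
      RatFunc.X ^ f.natDegree * aeval (RatFunc.X + RatFunc.C a * RatFunc.X⁻¹) f := by
  have hX : (RatFunc.X : RatFunc F) ≠ 0 := RatFunc.X_ne_zero
  rw [qTransform, aeval_eq_sum_range' (Nat.lt_succ_self _), sum_over_range _ (by simp), map_sum,
    Finset.mul_sum]
  refine Finset.sum_congr rfl fun k hk => ?_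
  have hk' : k ≤ f.natDegree := Nat.lt_succ_iff.mp (Finset.mem_range.mp hk)
  have h : (RatFunc.X ^ 2 + RatFunc.C a : RatFunc F) =
      RatFunc.X * (RatFunc.X + RatFunc.C a * RatFunc.X⁻¹) := by
    field_simp
  simp only [map_mul, map_pow, map_add, RatFunc.algebraMap_C, RatFunc.algebraMap_X]
  rw [h, mul_pow, ← Nat.sub_add_cancel hk', pow_add, Nat.sub_add_cancel hk', Algebra.smul_def,
    RatFunc.algebraMap_eq_C]
  ring

open Classical in
/-- The map `θ_a` on the projective line `K ∪ {∞}`: it sends `0` and `∞` to `∞`, and every other `x`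
to `x + a * x⁻¹`. -/
noncomputable def theta {K : Type*} [Field K] (a : K) (x : OnePoint K) : OnePoint K :=
  x.elim OnePoint.infty fun y => if y = 0 then OnePoint.infty else ((y + a * y⁻¹ : K) : OnePoint K)

/-! Writing `α = c ^ 2` and dividing roots by `c` reduces everything to `θ_1`. On the curve `y ^ 2 +
x y = x ^ 3 + 1`, doubling acts on abscissas as `θ_1` followed by Frobenius (`abscissa_two_nsmul`),
so climbing the tower resembles halving points. As long as the degree divides `2n`, a root above
level 0 and its inverse have equal traces in the field with `2 ^ (2sn)` elements, so the root is the
abscissa of a rational point (`exists_curve_point`). Non-periodicity forces the order of that point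
to carry a power of 2 growing with the level; a multiple of 2-power order then has an abscissa of
2-power degree over the prime field, which must divide `2sn`. This bounds the level.

When the degree stops dividing `2n`, the last root that still fits and its inverse have trace one.
`IsTraceOne.double` carries this property up each quadratic extension, so the degree doubles forever
(`exists_degree_doubling`). -/

/-! ### Traces and the equation `y + y⁻¹ = x` in characteristic two. -/

section TraceSum

variable {K : Type*} [Field K]

/-- The sum `x + x ^ 2 + ⋯ + x ^ (2 ^ (M - 1))`, which on the field with `2 ^ M` elements is the
absolute trace. -/
def traceSum (M : ℕ) (x : K) : K := ∑ i ∈ Finset.range M, x ^ 2 ^ i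

@[simp] theorem traceSum_zero (M : ℕ) : traceSum M (0 : K) = 0 := by simp [traceSum]

theorem traceSum_add_self (M : ℕ) (x : K) :
    traceSum (M + M) x = traceSum M x + traceSum M (x ^ 2 ^ M) := by
  simp only [traceSum, Finset.sum_range_add, ← pow_mul, ← pow_add]

theorem pow_two_pow_mul {M : ℕ} {x : K} (hx : x ^ 2 ^ M = x) (k : ℕ) : x ^ 2 ^ (M * k) = x := by
  induction k with
  | zero => simp
  | succ k ih => rw [Nat.mul_succ, pow_add, pow_mul, ih, hx]

/-- `x` lies in the field with `2 ^ M` elements, and both `x` and `x⁻¹` have trace one there. -/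
structure IsTraceOne (M : ℕ) (x : K) : Prop where
  pow_eq : x ^ 2 ^ M = x
  trace_eq : traceSum M x = 1
  trace_inv_eq : traceSum M x⁻¹ = 1

theorem IsTraceOne.ne_zero {M : ℕ} {x : K} (h : IsTraceOne M x) : x ≠ 0 := by
  rintro rfl
  simpa using h.trace_eq

variable [CharP K 2]

theorem traceSum_add (M : ℕ) (x y : K) : traceSum M (x + y) = traceSum M x + traceSum M y := by
  simp only [traceSum, add_pow_char_pow, Finset.sum_add_distrib]

/-- The sum telescopes; its vanishing detects whether `z` lies in the field with `2 ^ M` elements.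
-/
theorem traceSum_sq_add (M : ℕ) (z : K) : traceSum M (z ^ 2 + z) = z ^ 2 ^ M + z := by
  induction M with
  | zero => simp [traceSum, CharTwo.add_self_eq_zero]
  | succ M ih =>
    rw [traceSum, Finset.sum_range_succ, ← traceSum, ih, add_pow_char_pow, ← pow_mul, ← pow_succ']
    linear_combination CharTwo.add_self_eq_zero (z ^ 2 ^ M)

theorem traceSum_sq {M : ℕ} {x : K} (hx : x ^ 2 ^ M = x) : traceSum M (x ^ 2) = traceSum M x := by
  have h := traceSum_sq_add M x
  rwa [traceSum_add, hx, CharTwo.add_self_eq_zero, CharTwo.add_eq_zero] at h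

theorem traceSum_double_of_pow_eq {M : ℕ} {x : K} (hx : x ^ 2 ^ M = x) :
    traceSum (M + M) x = 0 := by
  rw [traceSum_add_self, hx, CharTwo.add_self_eq_zero]

theorem traceSum_eq_zero_or_one {M : ℕ} {x : K} (hx : x ^ 2 ^ M = x) :
    traceSum M x = 0 ∨ traceSum M x = 1 := by
  have h : traceSum M x ^ 2 = traceSum M x := by
    conv_rhs => rw [← traceSum_sq hx]
    rw [traceSum, traceSum, sum_pow_char]
    exact Finset.sum_congr rfl fun i _ => pow_right_comm ..
  have h' : traceSum M x * (traceSum M x - 1) = 0 := by linear_combination h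
  exact (mul_eq_zero.mp h').imp_right sub_eq_zero.mp

theorem pow_two_pow_eq_or_inv {M : ℕ} {y : K} (hy : y ≠ 0)
    (h : (y + y⁻¹) ^ 2 ^ M = y + y⁻¹) : y ^ 2 ^ M = y ∨ y ^ 2 ^ M = y⁻¹ := by
  rw [add_pow_char_pow, inv_pow] at h
  have hw : y ^ 2 ^ M ≠ 0 := pow_ne_zero _ hy
  generalize y ^ 2 ^ M = w at *
  have h' : (w - y) * (w * y - 1) = 0 := by
    field_simp at h
    linear_combination h
  refine (mul_eq_zero.mp h').imp sub_eq_zero.mp fun h => ?_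
  exact eq_inv_of_mul_eq_one_left (sub_eq_zero.mp h)

theorem pow_two_pow_double {M : ℕ} {y : K} (hy : y ≠ 0)
    (h : (y + y⁻¹) ^ 2 ^ M = y + y⁻¹) : y ^ 2 ^ (M + M) = y := by
  rw [pow_add, pow_mul]
  rcases pow_two_pow_eq_or_inv hy h with h | h
  · rw [h, h]
  · rw [h, inv_pow, h, inv_inv]

/-- The equation `y + y⁻¹ = x` is solvable in the field with `2 ^ M` elements iff the trace of
`x⁻¹` vanishes. -/
theorem traceSum_inv_eq_zero_iff {M : ℕ} {y : K} (hy : y ≠ 0) (hx : y + y⁻¹ ≠ 0)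
    (h : (y + y⁻¹) ^ 2 ^ M = y + y⁻¹) : traceSum M (y + y⁻¹)⁻¹ = 0 ↔ y ^ 2 ^ M = y := by
  obtain ⟨x, hxy⟩ : ∃ x, x = y + y⁻¹ := ⟨_, rfl⟩
  rw [← hxy] at hx h ⊢
  -- Dividing `y ^ 2 + x y = 1` by `x ^ 2` gives an Artin-Schreier equation.
  have hz : (y / x) ^ 2 + y / x = x⁻¹ ^ 2 := by
    have : x * y = y ^ 2 + 1 := by rw [hxy]; field_simp
    field_simp
    linear_combination this + CharTwo.add_self_eq_zero (y ^ 2)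
  have hi : x⁻¹ ^ 2 ^ M = x⁻¹ := by rw [inv_pow, h]
  rw [← traceSum_sq hi, ← hz, traceSum_sq_add, div_pow, h, ← add_div, div_eq_zero_iff,
    CharTwo.add_eq_zero]
  simp [hx]

theorem IsTraceOne.pow_ne {M : ℕ} {y : K} (hy : y ≠ 0) (h : IsTraceOne M (y + y⁻¹)) :
    y ^ 2 ^ M ≠ y := fun h' =>
  one_ne_zero (h.trace_inv_eq ▸ (traceSum_inv_eq_zero_iff hy h.ne_zero h.pow_eq).mpr h')

/-- The conjugate of `y` is `y⁻¹`, so both traces collapse to the trace of `y + y⁻¹` one level down.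
-/
theorem IsTraceOne.double {M : ℕ} {y : K} (hy : y ≠ 0) (h : IsTraceOne M (y + y⁻¹)) :
    IsTraceOne (M + M) y := by
  have h1 := (pow_two_pow_eq_or_inv hy h.pow_eq).resolve_left (h.pow_ne hy)
  refine ⟨pow_two_pow_double hy h.pow_eq, ?_, ?_⟩
  · rw [traceSum_add_self, h1, ← traceSum_add, h.trace_eq]
  · rw [traceSum_add_self, inv_pow, h1, inv_inv, ← traceSum_add, add_comm, h.trace_eq]

theorem IsTraceOne.not_pow_eq_half {M : ℕ} {x : K} (h : IsTraceOne (M + M) x) : x ^ 2 ^ M ≠ x :=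
  fun h' => one_ne_zero (h.trace_eq ▸ traceSum_double_of_pow_eq h')

theorem pow_two_pow_gcd {a b : ℕ} {x : K} (ha : x ^ 2 ^ a = x) (hb : x ^ 2 ^ b = x) :
    x ^ 2 ^ a.gcd b = x := by
  have key (n : ℕ) : Function.IsPeriodicPt (frobenius K 2) n x ↔ x ^ 2 ^ n = x := by
    rw [Function.IsPeriodicPt, Function.IsFixedPt, iterate_frobenius]
  rw [← key] at *
  exact ha.gcd hb

/-- Trace one keeps `x` out of the half-degree subfield, so its degree is exactly `2 ^ k`, which
divides `M`. -/
theorem IsTraceOne.le_padicValNat {k M : ℕ} (hM : M ≠ 0) {x : K} (h : IsTraceOne (2 ^ k) x)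
    (hx : x ^ 2 ^ M = x) : k ≤ padicValNat 2 M := by
  rw [← padicValNat_dvd_iff_le hM]
  have hg := pow_two_pow_gcd hx h.pow_eq
  obtain ⟨j, hj, hjg⟩ := (Nat.dvd_prime_pow Nat.prime_two).mp (Nat.gcd_dvd_right M (2 ^ k))
  rcases hj.eq_or_lt with rfl | hlt
  · rw [← hjg]; exact Nat.gcd_dvd_left _ _
  · obtain ⟨k, rfl⟩ : ∃ l, k = l + 1 := ⟨k - 1, by omega⟩
    rw [pow_succ, mul_two] at h
    obtain ⟨c, hc⟩ := pow_dvd_pow 2 (Nat.le_of_lt_succ hlt)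
    refine absurd ?_ h.not_pow_eq_half
    rw [hc]
    exact pow_two_pow_mul (hjg ▸ hg) c

end TraceSum

/-! ### The dynamics of `θ_1` on the projective line. -/

section Theta

variable {K : Type*} [Field K]

@[simp] theorem theta_coe_zero (a : K) : theta a ((0 : K) : OnePoint K) = OnePoint.infty := by
  simp [theta]

theorem theta_coe (a : K) {x : K} (hx : x ≠ 0) :
    theta a (x : OnePoint K) = ((x + a * x⁻¹ : K) : OnePoint K) := by
  simp [theta, hx]

theorem theta_one_coe {x : K} (hx : x ≠ 0) :
    theta 1 (x : OnePoint K) = ((x + x⁻¹ : K) : OnePoint K) := by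
  rw [theta_coe 1 hx, one_mul]

theorem theta_iterate_infty (a : K) (k : ℕ) : (theta a)^[k] OnePoint.infty = OnePoint.infty :=
  Function.iterate_fixed rfl k

theorem ne_zero_of_theta_iterate_ne_infty {a x : K} {k : ℕ}
    (h : (theta a)^[k + 1] (x : OnePoint K) ≠ OnePoint.infty) : x ≠ 0 := by
  rintro rfl
  simp [theta_iterate_infty] at h

theorem map_theta_one {L : Type*} [Field L] (φ : K →+* L) :
    Function.Semiconj (OnePoint.map φ) (theta 1) (theta 1) := by
  intro x
  induction x using OnePoint.rec with
  | infty => rfl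
  | coe x =>
    by_cases hx : x = 0
    · subst hx; simp
    · rw [theta_one_coe hx, OnePoint.map_some, OnePoint.map_some,
        theta_one_coe ((map_ne_zero φ).mpr hx), map_add, map_inv₀]

/-- Scaling by `c` conjugates `θ_1` to `θ_{c ^ 2}`. -/
theorem map_mul_theta {c : K} (hc : c ≠ 0) :
    Function.Semiconj (OnePoint.map (c * ·)) (theta 1) (theta (c ^ 2)) := by
  intro x
  induction x using OnePoint.rec with
  | infty => rfl
  | coe x =>
    by_cases hx : x = 0
    · subst hx; simp
    · rw [theta_one_coe hx, OnePoint.map_some, OnePoint.map_some,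
        theta_coe _ (mul_ne_zero hc hx)]
      congr 1
      field_simp

/-- An element whose `θ_1`-orbit reaches `0` after `k + 1` steps lies in the field with
`2 ^ 2 ^ k` elements, and both it and its inverse have trace one there. -/
theorem isTraceOne_of_theta_iterate_eq_zero [CharP K 2] {k : ℕ} {x : K}
    (h : (theta 1)^[k + 1] (x : OnePoint K) = ((0 : K) : OnePoint K)) : IsTraceOne (2 ^ k) x := by
  have hx : x ≠ 0 := ne_zero_of_theta_iterate_ne_infty (h ▸ OnePoint.coe_ne_infty _)
  induction k generalizing x with
  | zero =>
    rw [zero_add, Function.iterate_one, theta_one_coe hx, OnePoint.coe_eq_coe] at h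
    have h1 : (x - 1) ^ 2 = 0 := by
      field_simp at h
      linear_combination h - CharTwo.add_self_eq_zero x
    obtain rfl : x = 1 := sub_eq_zero.mp (pow_eq_zero_iff two_ne_zero |>.mp h1)
    constructor <;> simp [traceSum]
  | succ k ih =>
    rw [Function.iterate_succ_apply, theta_one_coe hx] at h
    rw [pow_succ, mul_two]
    exact (ih h (ne_zero_of_theta_iterate_ne_infty (h ▸ OnePoint.coe_ne_infty _))).double hx

end Theta

/-! ### Point doubling on a Koblitz curve. -/

section Curve

variable (K : Type*) [Field K]

/-- The curve `y ^ 2 + x y = x ^ 3 + 1`. -/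
def koblitzCurve : WeierstrassCurve.Affine K :=
  { a₁ := 1, a₂ := 0, a₃ := 0, a₄ := 0, a₆ := 1 }

variable {K}

/-- The abscissa of a point, in the projective line. -/
noncomputable def abscissa : (koblitzCurve K).Point → OnePoint K
  | .zero => OnePoint.infty
  | .some x _ _ => (x : OnePoint K)

theorem abscissa_eq_infty_iff {P : (koblitzCurve K).Point} :
    abscissa P = OnePoint.infty ↔ P = 0 := by
  cases P with
  | zero => exact ⟨fun _ => rfl, fun _ => rfl⟩
  | some x y h => exact ⟨fun h => (OnePoint.coe_ne_infty _ h).elim, fun h => by cases h⟩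

theorem koblitzCurve_equation_iff {x y : K} :
    (koblitzCurve K).Equation x y ↔ y ^ 2 + x * y = x ^ 3 + 1 := by
  rw [WeierstrassCurve.Affine.equation_iff]
  simp [koblitzCurve]

variable [CharP K 2]

theorem exists_abscissa_eq {x y : K} (hx : x ≠ 0) (h : y ^ 2 + x * y = x ^ 3 + 1) :
    ∃ P : (koblitzCurve K).Point, abscissa P = (x : OnePoint K) := by
  refine ⟨.some x y ?_, rfl⟩
  rw [WeierstrassCurve.Affine.nonsingular_iff]
  refine ⟨koblitzCurve_equation_iff.mpr h, Or.inr fun hy => hx ?_⟩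
  simp only [koblitzCurve] at hy
  linear_combination hy - CharTwo.add_self_eq_zero y

/-- The map `x ↦ (x + x⁻¹) ^ 2` on the projective line. -/
noncomputable def thetaSq : OnePoint K → OnePoint K :=
  OnePoint.map (frobenius K 2) ∘ theta 1

open Classical in
theorem abscissa_two_nsmul (P : (koblitzCurve K).Point) :
    abscissa (2 • P) = thetaSq (abscissa P) := by
  rw [two_nsmul]
  cases P with
  | zero => rfl
  | some x y h =>
    have he := koblitzCurve_equation_iff.mp h.1
    by_cases hx : x = 0
    · subst hx
      rw [WeierstrassCurve.Affine.Point.add_self_of_Y_eq]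
      · simp only [thetaSq, abscissa, Function.comp_apply, theta_coe_zero, OnePoint.map_infty]
      · simp [koblitzCurve, WeierstrassCurve.Affine.negY, CharTwo.neg_eq]
    · have hy : y ≠ (koblitzCurve K).negY x y := fun hy => hx <| by
        simp only [koblitzCurve, WeierstrassCurve.Affine.negY] at hy
        linear_combination hy - CharTwo.add_self_eq_zero y
      rw [WeierstrassCurve.Affine.Point.add_self_of_Y_ne hy]
      simp only [thetaSq, abscissa, Function.comp_apply, theta_one_coe hx, OnePoint.map_some]
      congr 1
      rw [WeierstrassCurve.Affine.slope_of_Y_ne rfl hy]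
      have hd : y - (koblitzCurve K).negY x y = x := by
        simp only [koblitzCurve, WeierstrassCurve.Affine.negY]
        linear_combination CharTwo.add_self_eq_zero y
      rw [hd]
      simp only [koblitzCurve, WeierstrassCurve.Affine.addX, frobenius_def]
      have h2 : (2 : K) = 0 := CharTwo.two_eq_zero
      field_simp
      linear_combination he + (x ^ 2 * (4 * x ^ 2 - 3 * y) - x * y + x ^ 3 - x ^ 2 ) * h2

open Classical in
theorem abscissa_two_pow_nsmul (k : ℕ) (P : (koblitzCurve K).Point) :
    abscissa (2 ^ k • P) = thetaSq^[k] (abscissa P) := by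
  induction k with
  | zero => simp
  | succ k ih =>
    rw [pow_succ', mul_nsmul', abscissa_two_nsmul, ih, Function.iterate_succ_apply']

/-- `θ_1` is defined over the prime field, hence commutes with Frobenius. -/
theorem thetaSq_iterate (k : ℕ) :
    (thetaSq : OnePoint K → OnePoint K)^[k] =
      (OnePoint.map (frobenius K 2))^[k] ∘ (theta 1)^[k] :=
  Function.Commute.comp_iterate (map_theta_one (frobenius K 2)) k

theorem map_frobenius_iterate (k : ℕ) :
    (OnePoint.map (frobenius K 2))^[k] = OnePoint.map (fun x : K => x ^ 2 ^ k) := by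
  funext x
  induction x using OnePoint.rec with
  | infty => exact Function.iterate_fixed rfl k
  | coe x =>
    rw [OnePoint.map_some, ← iterate_frobenius]
    have h : Function.Semiconj ((↑) : K → OnePoint K) (frobenius K 2)
      (OnePoint.map (frobenius K 2)) := fun _ => rfl
    exact (h.iterate_right k x).symm

theorem map_frobenius_injective : Function.Injective (OnePoint.map (frobenius K 2)) :=
  Option.map_injective (frobenius_inj K 2)

theorem thetaSq_iterate_eq_infty_iff {k : ℕ} {x : OnePoint K} :
    thetaSq^[k] x = OnePoint.infty ↔ (theta 1)^[k] x = OnePoint.infty := by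
  rw [thetaSq_iterate, Function.comp_apply]
  conv_lhs => rw [← Function.iterate_fixed (OnePoint.map_infty (frobenius K 2)) k]
  exact (map_frobenius_injective.iterate k).eq_iff

theorem mem_periodicPts_theta_of_thetaSq {M : ℕ} (hM : M ≠ 0) (hK : ∀ x : K, x ^ 2 ^ M = x)
    {x : OnePoint K} (hx : x ∈ Function.periodicPts (thetaSq : OnePoint K → OnePoint K)) :
    x ∈ Function.periodicPts (theta (1 : K)) := by
  obtain ⟨j, hj, h⟩ := hx
  refine ⟨j * M, by positivity, ?_⟩
  have h' := h.mul_const M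
  rwa [Function.IsPeriodicPt, thetaSq_iterate, map_frobenius_iterate, mul_comm j,
    show (fun x : K => x ^ 2 ^ (M * j)) = id from funext fun x => pow_two_pow_mul (hK x) j,
    OnePoint.map_id, Function.id_comp, mul_comm M] at h'

theorem exists_two_pow_modEq_one_of_odd {k : ℕ} (hk : Odd k) : ∃ j, 0 < j ∧ 2 ^ j ≡ 1 [MOD k] :=
  ⟨k.totient, Nat.totient_pos.mpr hk.pos, Nat.ModEq.pow_totient hk.coprime_two_left⟩

open Classical in
/-- Over the field with `2 ^ M` elements, at most `v₂(M) + 2` successive `θ_1`-preimages can be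
taken of a point which is not periodic. -/
theorem le_of_theta_iterate_not_periodic [Finite K] {M N : ℕ} (hM : M ≠ 0)
    (hK : ∀ x : K, x ^ 2 ^ M = x) {x y : K} (hx : x ≠ 0) (hxy : y ^ 2 + x * y = x ^ 3 + 1)
    (hper : (theta 1)^[N] (x : OnePoint K) ∉ Function.periodicPts (theta (1 : K))) :
    N + 1 ≤ padicValNat 2 M + 2 := by
  obtain ⟨P, hP⟩ := exists_abscissa_eq hx hxy
  have : Finite (koblitzCurve K).Point := by
    let g : (koblitzCurve K).Point → Option (K × K)
      | .zero => none
      | .some x y _ => some (x, y)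
    refine Finite.of_injective g fun P Q h => ?_
    cases P <;> cases Q <;> simp_all [g]
  obtain ⟨e, k, hk, ha⟩ := Nat.exists_eq_two_pow_mul_odd (addOrderOf_pos P).ne'
  -- If `e ≤ N`, then `2 ^ N • P` has odd order, so doubling cycles it and its abscissa is periodic.
  rcases le_or_gt e N with he | he
  · refine (hper ?_).elim
    have hkQ : k • 2 ^ N • P = 0 := by
      rw [← mul_nsmul', ← addOrderOf_dvd_iff_nsmul_eq_zero, ha, mul_comm]
      exact mul_dvd_mul_left _ (pow_dvd_pow 2 he)
    obtain ⟨j, hj, hjk⟩ := exists_two_pow_modEq_one_of_odd hk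
    have h1 : 2 ^ j • 2 ^ N • P = 2 ^ N • P := by
      conv_rhs => rw [← one_nsmul (2 ^ N • P)]
      rw [nsmul_eq_nsmul_iff_modEq]
      exact hjk.of_dvd (addOrderOf_dvd_of_nsmul_eq_zero hkQ)
    refine mem_periodicPts_theta_of_thetaSq hM hK ⟨j, hj, ?_⟩
    have h2 := congrArg abscissa h1
    rw [abscissa_two_pow_nsmul, abscissa_two_pow_nsmul, hP, thetaSq_iterate N,
      Function.comp_apply] at h2
    have hc : Function.Commute (OnePoint.map (frobenius K 2))^[N] (thetaSq^[j]) := by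
      refine Function.Commute.iterate_iterate ?_ N j
      exact (Function.Commute.refl _).comp_right (map_theta_one (frobenius K 2))
    rw [← hc] at h2
    exact (map_frobenius_injective.iterate N) h2
  · obtain ⟨r, rfl⟩ : ∃ r, e = r + (N + 1) := ⟨e - (N + 1), by omega⟩
    -- `T` has order exactly `2 ^ (N + 1)`.
    set T := (2 ^ r * k) • P with hT
    have h1 : 2 ^ (N + 1) • T = 0 := by
      rw [hT, ← mul_nsmul', ← addOrderOf_dvd_iff_nsmul_eq_zero, ha]
      exact dvd_of_eq (by ring)
    have h2 : 2 ^ N • T ≠ 0 := by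
      rw [hT, ← mul_nsmul', Ne, ← addOrderOf_dvd_iff_nsmul_eq_zero, ha]
      intro h
      have := Nat.le_of_dvd (by have := hk.pos; positivity) h
      have h3 : 0 < 2 ^ N * (2 ^ r * k) := by have := hk.pos; positivity
      have h4 : 2 ^ (r + (N + 1)) * k = 2 * (2 ^ N * (2 ^ r * k)) := by ring
      omega
    rw [← abscissa_eq_infty_iff, abscissa_two_pow_nsmul, thetaSq_iterate_eq_infty_iff] at h1
    rw [Ne, ← abscissa_eq_infty_iff, abscissa_two_pow_nsmul, thetaSq_iterate_eq_infty_iff] at h2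
    cases N with
    | zero => omega
    | succ N =>
      -- Only `0` and `∞` map to `∞`, so the orbit passes through `0` just before reaching `∞`.
      have hz : (theta 1)^[N + 1] (abscissa T) = ((0 : K) : OnePoint K) := by
        rw [Function.iterate_succ_apply'] at h1
        generalize (theta 1)^[N + 1] (abscissa T) = u at h1 h2
        induction u using OnePoint.rec with
        | infty => exact (h2 rfl).elim
        | coe u =>
          by_contra hu
          rw [theta_one_coe (fun h => hu (congrArg _ h))] at h1
          exact OnePoint.coe_ne_infty _ h1
      generalize abscissa T = u at hz
      induction u using OnePoint.rec with
      | infty => exact (OnePoint.infty_ne_coe _ ((theta_iterate_infty _ _).symm.trans hz)).elim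
      | coe u =>
        have := (isTraceOne_of_theta_iterate_eq_zero hz).le_padicValNat hM (hK u)
        omega

end Curve

/-! ### Degrees along a tower of preimages. -/

section Degrees

variable {K : Type*} [Field K] [CharP K 2] [IsAlgClosed K]

theorem exists_curve_point {M : ℕ} {x : K} (hx : x ≠ 0) (hM : x ^ 2 ^ M = x)
    (htr : traceSum M x = traceSum M x⁻¹) :
    ∃ y : K, y ^ 2 ^ M = y ∧ y ^ 2 + x * y = x ^ 3 + 1 := by
  -- This is the curve equation after substituting `y = x z`.
  obtain ⟨z, hz⟩ : ∃ z : K, z ^ 2 + z = x + x⁻¹ ^ 2 := by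
    obtain ⟨z, hz⟩ := IsAlgClosed.exists_root (X ^ 2 + X - C (x + x⁻¹ ^ 2) : K[X]) (by
      have : (X ^ 2 + X - C (x + x⁻¹ ^ 2) : K[X]).degree = 2 := by compute_degree!
      rw [this]; decide)
    exact ⟨z, by simpa [sub_eq_zero] using hz⟩
  have hi : x⁻¹ ^ 2 ^ M = x⁻¹ := by rw [inv_pow, hM]
  have hzM : z ^ 2 ^ M = z := by
    rw [← CharTwo.add_eq_zero, ← traceSum_sq_add, hz, traceSum_add, traceSum_sq hi, htr,
      CharTwo.add_self_eq_zero]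
  refine ⟨x * z, by rw [mul_pow, hM, hzM], ?_⟩
  calc (x * z) ^ 2 + x * (x * z) = x ^ 2 * (z ^ 2 + z) := by ring
    _ = x ^ 3 + 1 := by rw [hz]; field_simp

theorem le_of_theta_iterate_not_periodic_of_isAlgClosed {M N : ℕ} (hM : M ≠ 0) {x : K}
    (hx : x ≠ 0) (hxM : x ^ 2 ^ M = x) (htr : traceSum M x = traceSum M x⁻¹)
    (hper : (theta 1)^[N] (x : OnePoint K) ∉ Function.periodicPts (theta (1 : K))) :
    N + 1 ≤ padicValNat 2 M + 2 := by
  obtain ⟨y, hyM, hxy⟩ := exists_curve_point hx hxM htr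
  let L : Subfield K := (iterateFrobenius K 2 M).eqLocusField (RingHom.id K)
  have hL (z : K) : z ∈ L ↔ z ^ 2 ^ M = z := by
    rw [RingHom.mem_eqLocusField, iterateFrobenius_def, RingHom.id_apply]
  have hfin : Finite L := by
    have h1 : 1 < 2 ^ M := Nat.one_lt_two_pow hM
    have hne : (X ^ 2 ^ M - X : K[X]) ≠ 0 := FiniteField.X_pow_card_sub_X_ne_zero K h1
    refine Set.Finite.subset (Polynomial.rootSet_finite (X ^ 2 ^ M - X : K[X]) K) fun z hz => ?_
    rw [Polynomial.mem_rootSet]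
    exact ⟨hne, by simpa [sub_eq_zero] using (hL z).mp hz⟩
  have : CharP L 2 := (algebraMap L K).charP (algebraMap L K).injective 2
  refine le_of_theta_iterate_not_periodic (K := L) hM (fun z => Subtype.ext ((hL z).mp z.2))
    (x := ⟨x, (hL x).mpr hxM⟩) (y := ⟨y, (hL y).mpr hyM⟩) (fun h => hx (congrArg Subtype.val h))
    (Subtype.ext hxy) ?_
  rintro ⟨j, hj, h⟩
  refine hper ⟨j, hj, ?_⟩
  have h' := h.map (map_theta_one L.subtype)
  rwa [(map_theta_one L.subtype).iterate_right N] at h'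

/-- The degrees along a tower of `θ_1`-preimages. Here `R i` is the set of elements at level `i`,
and `d i` is their common degree over the field with `2 ^ s` elements. -/
theorem exists_degree_doubling {s n : ℕ} (hs : 0 < s) (hn : 0 < n) (R : ℕ → K → Prop) (d : ℕ → ℕ)
    (hex : ∀ i, ∃ b, R i b) (hstep : ∀ i b, R (i + 1) b → b ≠ 0 ∧ R i (b + b⁻¹))
    (hdeg : ∀ i b, R i b → ∀ k, b ^ 2 ^ (s * k) = b ↔ d i ∣ k) (h0 : d 0 = n)
    (hper : ∀ b, R 1 b → (b : OnePoint K) ∉ Function.periodicPts (theta (1 : K))) :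
    ∃ t, 0 < t ∧ t ≤ padicValNat 2 s + padicValNat 2 n + 3 ∧ d t = 2 * n ∧
      ∀ i, t ≤ i → d (i + 1) = 2 * d i := by
  have hpow {M : ℕ} {b : K} (h : b ^ 2 ^ M = b) : (b + b⁻¹) ^ 2 ^ M = b + b⁻¹ := by
    rw [add_pow_char_pow, inv_pow, h]
  have hdvd (i : ℕ) : d i ∣ d (i + 1) := by
    obtain ⟨b, hb⟩ := hex (i + 1)
    exact (hdeg i _ (hstep i b hb).2 _).mp (hpow ((hdeg _ b hb _).mpr dvd_rfl))
  have hdvd2 (i : ℕ) : d (i + 1) ∣ 2 * d i := by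
    obtain ⟨b, hb⟩ := hex (i + 1)
    obtain ⟨hb0, hb'⟩ := hstep i b hb
    have h := pow_two_pow_double hb0 ((hdeg i _ hb' (d i)).mpr dvd_rfl)
    rw [← mul_add, ← two_mul] at h
    exact (hdeg _ b hb _).mp h
  have hndvd (i : ℕ) : n ∣ d i := by
    induction i with
    | zero => rw [h0]
    | succ i ih => exact ih.trans (hdvd i)
  have htwo {a c : ℕ} (ha : 0 < a) (h1 : a ∣ c) (h2 : c ∣ 2 * a) (h3 : ¬ c ∣ a) : c = 2 * a := by
    obtain ⟨e, rfl⟩ := h1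
    rw [mul_comm 2] at h2 ⊢
    rcases (Nat.dvd_prime Nat.prime_two).mp (Nat.dvd_of_mul_dvd_mul_left ha h2) with rfl | rfl
    · exact (h3 (by simp)).elim
    · rfl
  have hpos (i : ℕ) : 0 < d i := by
    induction i with
    | zero => rwa [h0]
    | succ i ih => exact Nat.pos_of_dvd_of_pos (hdvd2 i) (by positivity)
  obtain ⟨M, hMdef⟩ : ∃ M, M = s * n := ⟨_, rfl⟩
  have hM2 : s * (2 * n) = M + M := by rw [hMdef]; ring
  -- At level 1, `b + b⁻¹` lies in the half-degree field and has trace zero. Higher up, solvability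
  -- kills the trace of `(b + b⁻¹)⁻¹`, and the previous level then kills that of `b + b⁻¹`.
  have htr (i : ℕ) (b : K) (hb : R (i + 1) b) (hbM : b ^ 2 ^ (M + M) = b) :
      traceSum (M + M) b = traceSum (M + M) b⁻¹ := by
    rw [← CharTwo.add_eq_zero, ← traceSum_add]
    induction i generalizing b with
    | zero =>
      apply traceSum_double_of_pow_eq
      rw [hMdef]
      exact (hdeg 0 _ (hstep 0 b hb).2 n).mpr h0.dvd
    | succ i ih =>
      obtain ⟨hb0, hx⟩ := hstep _ b hb
      have h := ih _ hx (hpow hbM)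
      rwa [traceSum_add, (traceSum_inv_eq_zero_iff hb0 (hstep i _ hx).1 (hpow hbM)).mpr hbM,
        add_zero] at h
  have hiter (N : ℕ) (b : K) (hb : R (N + 1) b) :
      ∃ c, R 1 c ∧ (theta 1)^[N] (b : OnePoint K) = (c : OnePoint K) := by
    induction N generalizing b with
    | zero => exact ⟨b, hb, rfl⟩
    | succ N ih =>
      obtain ⟨hb0, hx⟩ := hstep _ b hb
      rw [Function.iterate_succ_apply, theta_one_coe hb0]
      exact ih _ hx
  have hbound (N : ℕ) (h : d (N + 1) ∣ 2 * n) : N + 1 ≤ padicValNat 2 s + padicValNat 2 n + 3 := by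
    obtain ⟨b, hb⟩ := hex (N + 1)
    have hbM : b ^ 2 ^ (M + M) = b := by rw [← hM2]; exact (hdeg _ b hb _).mpr h
    obtain ⟨c, hc, hcb⟩ := hiter N b hb
    have hM0 : M + M ≠ 0 := by rw [← hM2]; positivity
    have hle := le_of_theta_iterate_not_periodic_of_isAlgClosed hM0 (hstep N b hb).1 hbM
      (htr N b hb hbM) (hcb ▸ hper c hc)
    rw [← hM2, padicValNat.mul hs.ne' (by positivity), padicValNat.mul two_ne_zero hn.ne',
      padicValNat_self] at hle
    omega
  -- Level `t + 1`, the final witness, is where the next degree stops dividing `2n`.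
  obtain ⟨t, ht, htn⟩ : ∃ t, d (t + 1) ∣ 2 * n ∧ ¬ d (t + 2) ∣ 2 * n := by
    by_contra! hcon
    have hall (N : ℕ) : d (N + 1) ∣ 2 * n := by
      induction N with
      | zero => exact h0 ▸ hdvd2 0
      | succ N ih => exact hcon N ih
    have := hbound _ (hall (padicValNat 2 s + padicValNat 2 n + 3))
    omega
  have hbase (b : K) (hb : R (t + 2) b) : IsTraceOne (M + M) (b + b⁻¹) := by
    obtain ⟨hb0, hx⟩ := hstep _ b hb
    have hxM : (b + b⁻¹) ^ 2 ^ (M + M) = b + b⁻¹ := by rw [← hM2]; exact (hdeg _ _ hx _).mpr ht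
    have hbM : b ^ 2 ^ (M + M) ≠ b := by rw [← hM2]; exact fun h => htn ((hdeg _ b hb _).mp h)
    have hinv : (b + b⁻¹)⁻¹ ^ 2 ^ (M + M) = (b + b⁻¹)⁻¹ := by rw [inv_pow, hxM]
    have h1 : traceSum (M + M) (b + b⁻¹)⁻¹ = 1 :=
      (traceSum_eq_zero_or_one hinv).resolve_left fun h =>
        hbM ((traceSum_inv_eq_zero_iff hb0 (hstep _ _ hx).1 hxM).mp h)
    exact ⟨hxM, (htr t _ hx hxM).trans h1, h1⟩
  -- The only other option is `n`, which trace one over the quadratic extension rules out.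
  have hdt : d (t + 1) = 2 * n := by
    refine htwo hn (hndvd _) ht fun h => ?_
    obtain ⟨b, hb⟩ := hex (t + 2)
    have h' := (hdeg _ _ (hstep _ b hb).2 n).mpr h
    rw [← hMdef] at h'
    exact (hbase b hb).not_pow_eq_half h'
  have hdouble (i : ℕ) (b : K) (hb : R (i + 1) b) (h : IsTraceOne (s * d i) (b + b⁻¹)) :
      d (i + 1) = 2 * d i :=
    htwo (hpos i) (hdvd i) (hdvd2 i) fun h' =>
      h.pow_ne (hstep i b hb).1 ((hdeg _ b hb _).mpr h')
  have hind (j : ℕ) : ∀ b, R (t + 1 + j + 1) b → IsTraceOne (s * d (t + 1 + j)) (b + b⁻¹) := by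
    induction j with
    | zero =>
      intro b hb
      rw [add_zero, hdt, hM2]
      exact hbase b hb
    | succ j ih =>
      intro b hb
      obtain ⟨-, hx⟩ := hstep _ b hb
      rw [← add_assoc] at hx
      have h := ih _ hx
      rw [← add_assoc, hdouble _ _ hx h, two_mul, mul_add]
      exact h.double (hstep _ _ hx).1
  refine ⟨t + 1, t.succ_pos, hbound t ht, hdt, fun i hi => ?_⟩
  obtain ⟨j, rfl⟩ := Nat.exists_eq_add_of_le hi
  obtain ⟨b, hb⟩ := hex (t + 1 + j + 1)
  exact hdouble _ b hb (hind j b hb)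

end Degrees

/-! ### Roots and factors of the transform. -/

section QTransform

variable {F : Type*} [Field F]

theorem natDegree_qTransform_le (a : F) (f : F[X]) :
    (qTransform a f).natDegree ≤ 2 * f.natDegree := by
  refine natDegree_sum_le_of_forall_le _ _ fun k hk => ?_
  have hk' : k ≤ f.natDegree := le_natDegree_of_mem_supp k hk
  have h : (C (f.coeff k) * (X ^ 2 + C a) ^ k * X ^ (f.natDegree - k)).natDegree ≤
      k * 2 + (f.natDegree - k) := by
    compute_degree
  exact h.trans (by omega)

theorem aeval_qTransform {K : Type*} [Field K] [Algebra F K] (a : F) (f : F[X]) {b : K}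
    (hb : b ≠ 0) : aeval b (qTransform a f) =
      b ^ f.natDegree * aeval (b + algebraMap F K a * b⁻¹) f := by
  rw [aeval_eq_sum_range' (p := f) (Nat.lt_succ_self _), qTransform, sum_over_range _ (by simp),
    map_sum, Finset.mul_sum]
  refine Finset.sum_congr rfl fun k hk => ?_
  obtain ⟨r, hr⟩ := Nat.exists_eq_add_of_le (Nat.lt_succ_iff.mp (Finset.mem_range.mp hk))
  have h : b ^ 2 + algebraMap F K a = b * (b + algebraMap F K a * b⁻¹) := by field_simp
  simp only [map_mul, map_pow, map_add, aeval_C, aeval_X]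
  rw [h, mul_pow, hr, Nat.add_sub_cancel_left, pow_add, Algebra.smul_def]
  ring

theorem eval_zero_qTransform (a : F) (f : F[X]) :
    (qTransform a f).eval 0 = f.leadingCoeff * a ^ f.natDegree := by
  rw [qTransform, sum_over_range _ (by simp), eval_finsetSum,
    Finset.sum_eq_single_of_mem f.natDegree (by simp)]
  · simp
  · intro k hk hne
    have : f.natDegree - k ≠ 0 := by
      have := Finset.mem_range.mp hk
      omega
    simp [this]

/-- The transform has degree at most `2 * f.natDegree`, so the cofactor of `g` is a unit. -/
theorem irreducible_qTransform_of_dvd {a : F} (ha : a ≠ 0) {f g : F[X]} (hf : f ≠ 0)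
    (hg : Irreducible g) (hdvd : g ∣ qTransform a f) (hdeg : g.natDegree = 2 * f.natDegree) :
    Irreducible (qTransform a f) := by
  have h0 : qTransform a f ≠ 0 := fun h => by
    have := eval_zero_qTransform a f
    rw [h, eval_zero] at this
    exact mul_ne_zero (leadingCoeff_ne_zero.mpr hf) (pow_ne_zero _ ha) this.symm
  obtain ⟨u, hu⟩ := hdvd
  have hu0 : u ≠ 0 := by rintro rfl; simp [hu] at h0
  have hle := natDegree_qTransform_le a f
  rw [hu, natDegree_mul hg.ne_zero hu0] at hle
  have hunit : IsUnit u := by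
    rw [isUnit_iff_degree_eq_zero, degree_eq_natDegree hu0]
    exact_mod_cast (by omega : u.natDegree = 0)
  rw [hu]
  exact (irreducible_mul_isUnit hunit).mpr hg

theorem root_of_dvd_qTransform {K : Type*} [Field K] [Algebra F K] {a : F} (ha : a ≠ 0)
    {f g : F[X]} (hf : f ≠ 0) (hdvd : g ∣ qTransform a f) {b : K} (hb : aeval b g = 0) :
    b ≠ 0 ∧ aeval (b + algebraMap F K a * b⁻¹) f = 0 := by
  have hq : aeval b (qTransform a f) = 0 := aeval_eq_zero_of_dvd_aeval_eq_zero hdvd hb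
  have hb0 : b ≠ 0 := by
    rintro rfl
    rw [← map_zero (algebraMap F K), aeval_algebraMap_apply_eq_algebraMap_eval,
      eval_zero_qTransform] at hq
    exact mul_ne_zero (leadingCoeff_ne_zero.mpr hf) (pow_ne_zero _ ha)
      ((algebraMap F K).injective hq)
  rw [aeval_qTransform a f hb0] at hq
  exact ⟨hb0, (mul_eq_zero.mp hq).resolve_left (pow_ne_zero _ hb0)⟩

theorem pow_card_pow_eq_iff_natDegree_dvd [Finite F] {K : Type*} [Field K] [Algebra F K]
    {f : F[X]} (hf : f.Monic) (hi : Irreducible f) {b : K} (hb : aeval b f = 0) (k : ℕ) :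
    b ^ Nat.card F ^ k = b ↔ f.natDegree ∣ k := by
  rw [hi.natDegree_dvd_iff_dvd_X_pow_card_pow_sub_X,
    minpoly.eq_of_irreducible_of_monic hi hb hf, minpoly.dvd_iff]
  simp [sub_eq_zero]

end QTransform

theorem theorem3p2 {F : Type*} [Field F] [Finite F] (s n : ℕ) (hs : 0 < s)
    (hF : Nat.card F = 2 ^ s) (α : F) (hα : α ≠ 0) (f : ℕ → F[X])
    (hmonic : ∀ i, (f i).Monic) (hirr : ∀ i, Irreducible (f i)) (hn : (f 0).natDegree = n)
    (hdvd : ∀ i, f (i + 1) ∣ qTransform α (f i))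
    (hper : ∀ β : AlgebraicClosure F, aeval β (f 1) = 0 →
      (β : OnePoint (AlgebraicClosure F)) ∉
        Function.periodicPts (theta (algebraMap F (AlgebraicClosure F) α))) :
    ∃ t : ℕ, 0 < t ∧ t ≤ padicValNat 2 s + padicValNat 2 n + 3 ∧
      (f t).natDegree = 2 * n ∧ (f (t + 1)).natDegree = 4 * n ∧
      ∀ i, t ≤ i → Irreducible (qTransform α (f i)) ∧
        (f (i + 1)).natDegree = 2 * (f i).natDegree := by
  have hF2 : CharP F 2 := by
    have := Fintype.ofFinite F
    exact charP_of_card_eq_prime_pow (f := s) (by rw [← Nat.card_eq_fintype_card, hF])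
  have hK2 : CharP (AlgebraicClosure F) 2 :=
    charP_of_injective_algebraMap (algebraMap F (AlgebraicClosure F)).injective 2
  obtain ⟨c, rfl⟩ : ∃ c : F, c ^ 2 = α :=
    -- The inverse of Frobenius on a field with `2 ^ s` elements.
    ⟨α ^ 2 ^ (s - 1), by
      have := Fintype.ofFinite F
      rw [← pow_mul, ← pow_succ, Nat.sub_add_cancel hs, ← hF, Nat.card_eq_fintype_card,
        FiniteField.pow_card]⟩
  have hc : c ≠ 0 := by rintro rfl; simp at hα
  set γ := algebraMap F (AlgebraicClosure F) c with hγdef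
  have hγ : γ ≠ 0 := (_root_.map_ne_zero _).mpr hc
  have hγpow (k : ℕ) : γ ^ 2 ^ (s * k) = γ := by
    refine pow_two_pow_mul ?_ k
    have := Fintype.ofFinite F
    rw [hγdef, ← map_pow, ← hF, Nat.card_eq_fintype_card, FiniteField.pow_card]
  obtain ⟨t, ht0, ht, hdt, hdouble⟩ := exists_degree_doubling (K := AlgebraicClosure F) hs
    (hn ▸ (hirr 0).natDegree_pos) (fun i b => aeval (γ * b) (f i) = 0)
    (fun i => (f i).natDegree)
    (fun i => by
      obtain ⟨b, hb⟩ := IsAlgClosed.exists_aeval_eq_zero (AlgebraicClosure F) (f i)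
        (degree_pos_of_irreducible (hirr i)).ne'
      exact ⟨γ⁻¹ * b, by rwa [mul_inv_cancel_left₀ hγ]⟩)
    (fun i b hb => by
      obtain ⟨h0, h⟩ := root_of_dvd_qTransform hα (hirr i).ne_zero (hdvd i) hb
      have hb0 : b ≠ 0 := right_ne_zero_of_mul h0
      refine ⟨hb0, ?_⟩
      have he : γ * (b + b⁻¹) =
          γ * b + algebraMap F (AlgebraicClosure F) (c ^ 2) * (γ * b)⁻¹ := by
        rw [map_pow, ← hγdef]
        field_simp
      rwa [he])
    (fun i b hb k => by
      rw [← pow_card_pow_eq_iff_natDegree_dvd (hmonic i) (hirr i) hb, hF, ← pow_mul, mul_pow,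
        hγpow, mul_right_inj' hγ])
    hn
    (fun b hb ⟨j, hj, h⟩ => hper _ hb ⟨j, hj, by
      rw [map_pow]
      exact h.map (map_mul_theta hγ)⟩)
  refine ⟨t, ht0, ht, hdt, ?_, fun i hi => ⟨?_, hdouble i hi⟩⟩
  · rw [hdouble t le_rfl, hdt]; ring
  · exact irreducible_qTransform_of_dvd hα (hirr i).ne_zero (hirr _) (hdvd i) (hdouble i hi)
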